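/- All graphs are finite, undirected and without loops. For $k\ge 1$, let $P_k$ denote the path with $k$ edges (hence $k+1$ vertices), and let $C_5$ be the cycle on five vertices. For a graph $G=(V,E)$ and $v\in V$ write $vE=\{u\in V: vu\in E\}$. The reduced form $\widehat G$ of $G$ is the graph with vertex set $\{vE: v\in V\}$ in which $uE$ and $vE$ are adjacent iff $uv\in E$ (this is well defined), and $G$ is of type $H$ if $\widehat G$ is isomorphic to $H$. Let the edges of a graph be colored by the elements of a finite set $\Gamma$ (arbitrarily, so incident edges may share a color). A Gallai clique is a nonempty set $a$ of pairwise adjacent vertices, regarded as the complete graph on $a$ with the restricted coloring, in which no triangle has edges of three different colors; it is an exact Gallai clique if, moreover, every triangle in it has edges of exactly two colors. A monochrome of a colored graph is a connected component of the graph $G(\alpha)$ formed by all its vertices and its edges of color $\alpha$, for some $\alpha\in\Gamma$, considered as an uncolored graph; it is spanning if it contains all the vertices. Proposition. (1) Every monochrome with more than one vertex of an exact Gallai clique is of type $P_1$, $P_3$ or $C_5$. (2) Conversely, every finite graph of type $P_1$, $P_3$ or $C_5$ is isomorphic to a spanning monochrome of some exact Gallai clique. -/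

import Mathlib

/-- The reduced form of a graph `G = (V, E)`: its vertices are the neighborhoods `vE` of the
vertices `v` of `G`, and `(uE)(vE)` is an edge iff `uv` is an edge of `G`. -/
def reducedForm {V : Type*} (G : SimpleGraph V) : SimpleGraph (Set.range G.neighborSet) where
  Adj A B := ∃ u v : V, G.neighborSet u = A ∧ G.neighborSet v = B ∧ G.Adj u v
  symm := ⟨fun _ _ ⟨u, v, hu, hv, h⟩ => ⟨v, u, hv, hu, h.symm⟩⟩
  loopless := ⟨fun A ⟨u, v, hu, hv, h⟩ => by
    have h1 : v ∈ G.neighborSet u := h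
    rw [hu, ← hv] at h1
    exact G.loopless.irrefl v h1⟩

/-- `G` is of type `H`: the reduced form of `G` is isomorphic to `H`. -/
def IsOfType {V W : Type*} (G : SimpleGraph V) (H : SimpleGraph W) : Prop :=
  Nonempty (reducedForm G ≃g H)

/-- `G` is of one of the types `P₁` (2 vertices), `P₃` (4 vertices), `C₅`.
Here `P_k` is the path with `k` edges, which is `SimpleGraph.pathGraph (k + 1)`. -/
def IsOfTypeP1P3C5 {V : Type*} (G : SimpleGraph V) : Prop :=
  IsOfType G (SimpleGraph.pathGraph 2) ∨ IsOfType G (SimpleGraph.pathGraph 4) ∨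
    IsOfType G (SimpleGraph.cycleGraph 5)

section ColoredGraphs

variable {V Γ : Type*} {G : SimpleGraph V}

/-- A Gallai clique of a graph `G` with edge coloring `C`: a nonempty set of pairwise adjacent
vertices without colorful triangles, i.e. no triangle has three different edge colors. -/
def IsGallaiClique (C : G.EdgeLabeling Γ) (a : Set V) : Prop :=
  a.Nonempty ∧ G.IsClique a ∧
    ∀ u ∈ a, ∀ v ∈ a, ∀ w ∈ a, ∀ (huv : G.Adj u v) (hvw : G.Adj v w) (hwu : G.Adj w u),
      ¬ (C.get u v huv ≠ C.get v w hvw ∧ C.get v w hvw ≠ C.get w u hwu ∧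
          C.get w u hwu ≠ C.get u v huv)

/-- An exact Gallai clique: a Gallai clique in which every triangle has edges of exactly two
colors. -/
def IsExactGallaiClique (C : G.EdgeLabeling Γ) (a : Set V) : Prop :=
  IsGallaiClique C a ∧
    ∀ u ∈ a, ∀ v ∈ a, ∀ w ∈ a, ∀ (huv : G.Adj u v) (hvw : G.Adj v w) (hwu : G.Adj w u),
      ({C.get u v huv, C.get v w hvw, C.get w u hwu} : Set Γ).ncard = 2

/-- The restriction of an edge coloring of `G` to the subgraph induced by `a`. -/
def restrictColoring (C : G.EdgeLabeling Γ) (a : Set V) : (G.induce a).EdgeLabeling Γ :=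
  C.pullback (SimpleGraph.Embedding.induce a).toHom

/-- `M` is a monochrome of the graph `G` with edge coloring `C`: for some color `α`, it is a
connected component of the graph `G(α)` formed by all the vertices of `G` and the edges of
color `α` (`C.labelGraph α`). -/
def IsMonochrome (C : G.EdgeLabeling Γ) (M : G.Subgraph) : Prop :=
  ∃ (α : Γ) (c : (C.labelGraph α).ConnectedComponent), M.verts = c.supp ∧
    ∀ u v : V, M.Adj u v ↔ u ∈ c.supp ∧ v ∈ c.supp ∧ (C.labelGraph α).Adj u v

end ColoredGraphs

/-! Exactness forbids monochromatic triangles, so a monochrome is triangle-free. Three vertices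
independent in it span a triangle in which `x` sees `y` and `z` in one color and `yz` has another;
connectedness then forces `y` and `z` to be twins (`adj_of_color_ne`). Hence the reduced form is
connected and has no twins, triangles or independent triples, which leaves P₁, P₃ and C₅
(`iso_of_cliqueFree_of_indepSetFree`).

Conversely, these three graphs have those properties, so a graph of such a type has no triangle and
no independent triple of pairwise non-twins. Coloring edges, non-adjacent non-twins and twins apart,
and twins by their minimum, is then exact (`twinColor_triangle`). -/

theorem SimpleGraph.Preconnected.forall_of_closed {V : Type*} {G : SimpleGraph V}
    (hG : G.Preconnected) {P : V → Prop} (hP : ∀ s t, G.Adj s t → P s → P t) {s : V} (hs : P s)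
    (t : V) : P t := by
  obtain ⟨w⟩ := hG s t
  induction w with
  | nil => exact hs
  | cons h _ ih => exact ih (hP _ _ h hs)

/-! ### Twins and connectedness under reduction. -/

section ReducedForm

variable {V : Type*} (G : SimpleGraph V)

theorem neighborSet_eq_iff {u v : V} :
    G.neighborSet u = G.neighborSet v ↔ ∀ w, G.Adj u w ↔ G.Adj v w := by
  simp [Set.ext_iff]

theorem reducedForm_adj_mk (u v : V) :
    (reducedForm G).Adj ⟨G.neighborSet u, u, rfl⟩ ⟨G.neighborSet v, v, rfl⟩ ↔ G.Adj u v := by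
  constructor
  · rintro ⟨u', v', hu, hv, h⟩
    rw [neighborSet_eq_iff] at hu hv
    exact ((hv u).1 ((hu v').1 h).symm).symm
  · exact fun h => ⟨u, v, rfl, rfl, h⟩

/-- The reduced form has no twins. -/
theorem reducedForm_ext {A B : Set.range G.neighborSet}
    (h : ∀ D, (reducedForm G).Adj A D ↔ (reducedForm G).Adj B D) : A = B := by
  obtain ⟨_, u, rfl⟩ := A
  obtain ⟨_, v, rfl⟩ := B
  refine Subtype.ext ((neighborSet_eq_iff G).2 fun w => ?_)
  simpa only [reducedForm_adj_mk] using h ⟨_, w, rfl⟩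

theorem reducedForm_preconnected (hG : G.Preconnected) : (reducedForm G).Preconnected := by
  rintro ⟨_, u, rfl⟩ ⟨_, v, rfl⟩
  exact hG.forall_of_closed (P := fun t => (reducedForm G).Reachable ⟨_, u, rfl⟩ ⟨_, t, rfl⟩)
    (fun s t hst hs => hs.trans ((reducedForm_adj_mk G s t).2 hst).reachable)
    (SimpleGraph.Reachable.refl _) v

/-- A graph whose reduced form is connected and has an edge is connected. -/
theorem preconnected_of_reducedForm (hR : (reducedForm G).Preconnected)
    (hn : Nontrivial (Set.range G.neighborSet)) : G.Preconnected := by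
  have hdeg : ∀ u, ∃ w, G.Adj u w := fun u => by
    obtain ⟨⟨_, w, rfl⟩, hw⟩ := hR.exists_adj_of_nontrivial ⟨_, u, rfl⟩
    exact ⟨w, (reducedForm_adj_mk G u w).1 hw⟩
  -- Twins are joined through a common neighbor, which exists as no vertex is isolated.
  have htwin : ∀ u v, G.neighborSet u = G.neighborSet v → G.Reachable u v := fun u v h => by
    obtain ⟨w, hw⟩ := hdeg u
    exact hw.reachable.trans (((neighborSet_eq_iff G).1 h w).1 hw).symm.reachable
  intro u v
  refine hR.forall_of_closed (P := fun A => ∀ t, G.neighborSet t = A → G.Reachable u t)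
    (fun A B hAB hA t ht => ?_) (s := ⟨_, u, rfl⟩) (fun t ht => htwin u t ht.symm)
    ⟨_, v, rfl⟩ v rfl
  obtain ⟨s, t', hs, ht', hst⟩ := hAB
  exact (hA s hs).trans (hst.reachable.trans (htwin _ _ (ht'.trans ht.symm)))

end ReducedForm

/-! ### Classification of the reduced graphs. -/

section SmallGraphs

variable {V : Type*} {G : SimpleGraph V}

theorem nonempty_iso_of_bijective {W : Type*} {H : SimpleGraph W} (f : W → V)
    (hf : Function.Bijective f) (h : ∀ i j, G.Adj (f i) (f j) ↔ H.Adj i j) :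
    Nonempty (G ≃g H) :=
  ⟨RelIso.symm ⟨Equiv.ofBijective f hf, fun {i j} => h i j⟩⟩

/-- A nontrivial connected graph without twins, without triangles and without independent sets of
size three is one of the paths on two or four vertices and the cycle on five vertices. -/
theorem iso_of_cliqueFree_of_indepSetFree [Nontrivial V] (hc : G.Preconnected)
    (htwin : ∀ u v, (∀ w, G.Adj u w ↔ G.Adj v w) → u = v)
    (htri : ∀ u v w, G.Adj u v → G.Adj v w → ¬ G.Adj u w)
    (hind : ∀ u v w, u ≠ v → v ≠ w → u ≠ w → G.Adj u v ∨ G.Adj v w ∨ G.Adj u w) :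
    Nonempty (G ≃g SimpleGraph.pathGraph 2) ∨ Nonempty (G ≃g SimpleGraph.pathGraph 4) ∨
      Nonempty (G ≃g SimpleGraph.cycleGraph 5) := by
  have hsymm : ∀ u v, G.Adj u v → G.Adj v u := fun _ _ h => h.symm
  have hirr : ∀ u, ¬ G.Adj u u := fun u => G.loopless.irrefl u
  by_cases hP : ∃ a b c d, G.Adj a b ∧ G.Adj b c ∧ G.Adj c d ∧ ¬ G.Adj a d ∧ a ≠ d
  · right
    obtain ⟨a, b, c, d, hab, hbc, hcd, had, hne⟩ := hP
    have hac := htri a b c hab hbc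
    have hbd := htri b c d hbc hcd
    have nab : a ≠ b := hab.ne
    have nbc : b ≠ c := hbc.ne
    have ncd : c ≠ d := hcd.ne
    have nac : a ≠ c := by grind
    have nbd : b ≠ d := by grind
    -- The non-edges `ac`, `bd`, `ad` each force a neighbor of `e`; triangle-freeness leaves only
    -- `a` and `d`. Two such vertices would form a triangle with `a` or an independent triple with
    -- `b`, so there is at most one.
    have key : ∀ e, e ≠ a → e ≠ b → e ≠ c → e ≠ d →
        G.Adj e a ∧ ¬ G.Adj e b ∧ ¬ G.Adj e c ∧ G.Adj e d := by grind
    by_cases he : ∃ e, e ≠ a ∧ e ≠ b ∧ e ≠ c ∧ e ≠ d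
    · right
      obtain ⟨e, ea, eb, ec, ed⟩ := he
      obtain ⟨ha, hb, hc', hd⟩ := key e ea eb ec ed
      have hall : ∀ x, x = a ∨ x = b ∨ x = c ∨ x = d ∨ x = e := by
        intro x
        by_contra! hx
        have := key x hx.1 hx.2.1 hx.2.2.1 hx.2.2.2.1
        grind
      refine nonempty_iso_of_bijective ![a, b, c, d, e] ⟨?_, ?_⟩ ?_
      · intro i j
        fin_cases i <;> fin_cases j <;> simp <;> grind
      · intro x
        rcases hall x with rfl | rfl | rfl | rfl | rfl
        exacts [⟨0, rfl⟩, ⟨1, rfl⟩, ⟨2, rfl⟩, ⟨3, rfl⟩, ⟨4, rfl⟩]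
      · intro i j
        rw [SimpleGraph.cycleGraph_adj]
        fin_cases i <;> fin_cases j <;> simp <;> grind
    · left
      have hall : ∀ x, x = a ∨ x = b ∨ x = c ∨ x = d := by
        intro x
        by_contra! hx
        exact he ⟨x, hx⟩
      refine nonempty_iso_of_bijective ![a, b, c, d] ⟨?_, ?_⟩ ?_
      · intro i j
        fin_cases i <;> fin_cases j <;> simp <;> grind
      · intro x
        rcases hall x with rfl | rfl | rfl | rfl
        exacts [⟨0, rfl⟩, ⟨1, rfl⟩, ⟨2, rfl⟩, ⟨3, rfl⟩]
      · intro i j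
        rw [SimpleGraph.pathGraph_adj]
        fin_cases i <;> fin_cases j <;> simp <;> grind
  · left
    obtain ⟨a⟩ : Nonempty V := inferInstance
    obtain ⟨b, hab⟩ := hc.exists_adj_of_nontrivial a
    -- A vertex `w` telling `a` from `c` would extend `a b c` to a path excluded by `hP`; so `a` and
    -- `c` are twins, and the graph is a single edge.
    have key : ∀ a b c, G.Adj a b → G.Adj b c → c = a := by
      intro a b c hab hbc
      by_contra hca
      refine hca (htwin c a fun w => ?_)
      have := htri a b c hab hbc
      by_contra hw
      apply hP
      by_cases h : G.Adj a w
      · exact ⟨w, a, b, c, by grind⟩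
      · exact ⟨w, c, b, a, by grind⟩
    have hall : ∀ x, x = a ∨ x = b :=
      hc.forall_of_closed (P := fun x => x = a ∨ x = b) (by grind) (Or.inl rfl)
    refine nonempty_iso_of_bijective ![a, b] ⟨?_, ?_⟩ ?_
    · intro i j
      have := hab.ne
      fin_cases i <;> fin_cases j <;> simp <;> grind
    · intro x
      rcases hall x with rfl | rfl
      exacts [⟨0, rfl⟩, ⟨1, rfl⟩]
    · intro i j
      rw [SimpleGraph.pathGraph_adj]
      fin_cases i <;> fin_cases j <;> simp <;> grind

theorem isOfTypeP1P3C5_of_cliqueFree [Nontrivial V] (hc : G.Preconnected)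
    (htri : ∀ u v w, G.Adj u v → G.Adj v w → ¬ G.Adj u w)
    (hind : ∀ u v w, G.neighborSet u ≠ G.neighborSet v → G.neighborSet v ≠ G.neighborSet w →
      G.neighborSet u ≠ G.neighborSet w → G.Adj u v ∨ G.Adj v w ∨ G.Adj u w) :
    IsOfTypeP1P3C5 G := by
  have hnt : Nontrivial (Set.range G.neighborSet) := by
    obtain ⟨a⟩ : Nonempty V := inferInstance
    obtain ⟨b, hab⟩ := hc.exists_adj_of_nontrivial a
    exact ⟨⟨_, a, rfl⟩, ⟨_, b, rfl⟩, ((reducedForm_adj_mk G a b).2 hab).ne⟩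
  refine iso_of_cliqueFree_of_indepSetFree (reducedForm_preconnected G hc)
    (fun _ _ => reducedForm_ext G) ?_ ?_
  · rintro ⟨_, u, rfl⟩ ⟨_, v, rfl⟩ ⟨_, w, rfl⟩
    simpa only [reducedForm_adj_mk] using htri u v w
  · rintro ⟨_, u, rfl⟩ ⟨_, v, rfl⟩ ⟨_, w, rfl⟩
    intro h1 h2 h3
    simpa only [reducedForm_adj_mk] using hind u v w (fun e => h1 (Subtype.ext e))
      (fun e => h2 (Subtype.ext e)) (fun e => h3 (Subtype.ext e))

end SmallGraphs

/-! ### Color classes of exact Gallai colorings. -/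

section ColorClass

variable {V Γ : Type*} {G : SimpleGraph V} {c : V → V → Γ} {α : Γ}

/-- In a connected color class of an exact Gallai coloring, if `x` is joined to `y` and `z` by the
same color and `yz` has another color, all of them different from that of the class, then every
neighbor of `y` is a neighbor of `z`. -/
theorem adj_of_color_ne (hc : G.Preconnected) (hs : ∀ u v, c u v = c v u)
    (hA : ∀ u v, G.Adj u v ↔ u ≠ v ∧ c u v = α)
    (hg : ∀ u v w, u ≠ v → v ≠ w → w ≠ u → c u v = c v w ∨ c v w = c w u ∨ c w u = c u v)
    (hn : ∀ u v w, u ≠ v → v ≠ w → w ≠ u → ¬ (c u v = c v w ∧ c v w = c w u))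
    {x y z : V} (hxy : x ≠ y) (hyz : y ≠ z) (hxz : x ≠ z) (axy : ¬ G.Adj x y)
    (ayz : ¬ G.Adj y z) (axz : ¬ G.Adj x z) (h1 : c x y = c x z) (h2 : c y z ≠ c x y)
    {p : V} (hp : G.Adj p y) : G.Adj p z := by
  by_contra hpz
  have hsymm : ∀ u v, G.Adj u v → G.Adj v u := fun _ _ h => h.symm
  have hirr : ∀ u, ¬ G.Adj u u := fun u => G.loopless.irrefl u
  have htri : ∀ u v w, G.Adj u v → G.Adj v w → ¬ G.Adj u w := by grind
  -- The triangle `u v w` has color `α` on `vw` only, so its two other edges agree.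
  have hcol : ∀ u v w, G.Adj v w → ¬ G.Adj u v → ¬ G.Adj u w → u ≠ v → u ≠ w →
      c u v = c u w := by grind
  have hpc : c p z = c y z := by
    rw [hs p z, hs y z]
    exact hcol z p y hp (fun h => hpz h.symm) (fun h => ayz h.symm) (by grind) hyz.symm
  -- If `p` separates `y` from `z`, the vertices that see both as `x` does are closed under
  -- adjacency; connectedness would put `y` itself among them.
  let T : V → Prop := fun t => t ≠ y ∧ t ≠ z ∧ ¬ G.Adj t y ∧ ¬ G.Adj t z ∧ c t y = c x y ∧
    c t z = c x y
  have hT : ∀ t w, G.Adj t w → T t → T w := by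
    rintro t w htw ⟨ty, tz, aty, atz, cty, ctz⟩
    have hdiff : ¬ G.Adj t p := fun h => by
      have := hcol z t p h (by grind) (by grind) tz.symm (by grind)
      grind
    have wy : ¬ G.Adj w y := by
      intro hwy
      by_cases hwz : G.Adj w z
      -- Here `c t y = c t p = c p w = c p z = c y z`, although `c t y = c x y`.
      · have hwp : ¬ G.Adj w p := by grind
        have e1 := hcol p t w htw (by grind) (by grind) (by grind) (by grind)
        have e2 := hcol t p y hp hdiff aty (by grind) ty
        have e3 := hcol p w z hwz (by grind) hpz (by grind) (by grind)
        grind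
      · have := hcol z t w htw (by grind) (by grind) tz.symm (by grind)
        have := hcol z w y hwy (by grind) (by grind) (by grind) (by grind)
        grind
    have wz : ¬ G.Adj w z := by
      intro hwz
      have := hcol y t w htw (by grind) (by grind) (by grind) (by grind)
      have := hcol y w z hwz (by grind) (by grind) (by grind) (by grind)
      grind
    have e1 := hcol y t w htw (by grind) (by grind) (by grind) (by grind)
    have e2 := hcol z t w htw (by grind) (by grind) (by grind) (by grind)
    exact ⟨by grind, by grind, wy, wz, by grind, by grind⟩
  have hTy : T y := hc.forall_of_closed hT
    (s := x) ⟨hxy, hxz, axy, axz, rfl, h1.symm⟩ y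
  exact hTy.1 rfl

theorem isOfTypeP1P3C5_of_colorClass [Nontrivial V] (hc : G.Preconnected)
    (hs : ∀ u v, c u v = c v u)
    (hA : ∀ u v, G.Adj u v ↔ u ≠ v ∧ c u v = α)
    (hg : ∀ u v w, u ≠ v → v ≠ w → w ≠ u → c u v = c v w ∨ c v w = c w u ∨ c w u = c u v)
    (hn : ∀ u v w, u ≠ v → v ≠ w → w ≠ u → ¬ (c u v = c v w ∧ c v w = c w u)) :
    IsOfTypeP1P3C5 G := by
  have hsymm : ∀ u v, G.Adj u v → G.Adj v u := fun _ _ h => h.symm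
  have key : ∀ x y z, x ≠ y → y ≠ z → x ≠ z → ¬ G.Adj x y → ¬ G.Adj y z → ¬ G.Adj x z →
      c x y = c x z → G.neighborSet y = G.neighborSet z := by
    intro x y z hxy hyz hxz axy ayz axz h
    have h2 : c y z ≠ c x y := by grind
    refine (neighborSet_eq_iff G).2 fun p => ⟨fun hp => ?_, fun hp => ?_⟩
    · exact (adj_of_color_ne hc hs hA hg hn hxy hyz hxz axy ayz axz h h2 hp.symm).symm
    · exact (adj_of_color_ne hc hs hA hg hn hxz hyz.symm hxy axz (by grind) axy h.symm
        (by grind) hp.symm).symm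
  refine isOfTypeP1P3C5_of_cliqueFree hc (by grind) fun u v w huv hvw huw => ?_
  by_contra! h
  have nuv : u ≠ v := fun e => huv (e ▸ rfl)
  have nvw : v ≠ w := fun e => hvw (e ▸ rfl)
  have nuw : u ≠ w := fun e => huw (e ▸ rfl)
  rcases hg u v w nuv nvw nuw.symm with e | e | e
  · exact huw (key v u w nuv.symm nuw nvw (by grind) (by grind) (by grind) (by grind))
  · exact huv (key w u v nuw.symm nuv nvw.symm (by grind) (by grind) (by grind) (by grind))
  · exact hvw (key u v w nuv nvw nuw (by grind) (by grind) (by grind) (by grind))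

end ColorClass

theorem Set.ncard_triple_eq_two_iff {α : Type*} {x y z : α} :
    ({x, y, z} : Set α).ncard = 2 ↔ (x = y ∨ y = z ∨ z = x) ∧ ¬ (x = y ∧ y = z) := by
  classical
  have h : ({x, y, z} : Set α) = (({x, y, z} : Finset α) : Set α) := by simp
  rw [h, Set.ncard_coe_finset]
  by_cases hxy : x = y <;> by_cases hyz : y = z <;> by_cases hzx : z = x <;> grind

theorem isOfTypeP1P3C5_of_isMonochrome {V Γ : Type*} {G : SimpleGraph V} {C : G.EdgeLabeling Γ}
    {a : Set V} (ha : IsExactGallaiClique C a) {M : (G.induce a).Subgraph}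
    (hM : IsMonochrome (restrictColoring C a) M) (hnt : M.verts.Nontrivial) :
    IsOfTypeP1P3C5 M.coe := by
  classical
  obtain ⟨α, k, hv, hadj⟩ := hM
  obtain ⟨⟨-, hcl, -⟩, htwo⟩ := ha
  have hG : ∀ u v : M.verts, u ≠ v → G.Adj u.1.1 v.1.1 := fun u v h =>
    hcl u.1.2 v.1.2 fun e => h (Subtype.ext (Subtype.ext e))
  -- The default `α` is taken only on the diagonal, which `hA` excludes by `u ≠ v`.
  let c : M.verts → M.verts → Γ := fun u v =>
    if h : G.Adj u.1.1 v.1.1 then C.get u.1.1 v.1.1 h else α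
  have hcv : ∀ u v (h : u ≠ v), c u v = C.get u.1.1 v.1.1 (hG u v h) := fun u v h =>
    dif_pos (hG u v h)
  have htriple : ∀ u v w : M.verts, u ≠ v → v ≠ w → w ≠ u →
      (c u v = c v w ∨ c v w = c w u ∨ c w u = c u v) ∧ ¬ (c u v = c v w ∧ c v w = c w u) := by
    intro u v w h1 h2 h3
    rw [← Set.ncard_triple_eq_two_iff, hcv u v h1, hcv v w h2, hcv w u h3]
    exact htwo _ u.1.2 _ v.1.2 _ w.1.2 _ _ _
  have hMadj : ∀ u v : M.verts, M.coe.Adj u v ↔ ((restrictColoring C a).labelGraph α).Adj u v := by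
    intro u v
    have hu : u.1 ∈ k.supp := hv ▸ u.2
    have hv' : v.1 ∈ k.supp := hv ▸ v.2
    simp [hadj, hu, hv']
  have hA : ∀ u v, M.coe.Adj u v ↔ u ≠ v ∧ c u v = α := by
    intro u v
    rw [hMadj, SimpleGraph.EdgeLabeling.labelGraph_adj]
    constructor
    · rintro ⟨h, e⟩
      have hne : u ≠ v := fun e => h.ne (congrArg _ e)
      exact ⟨hne, (hcv u v hne).trans e⟩
    · rintro ⟨h, e⟩
      exact ⟨hG u v h, (hcv u v h).symm.trans e⟩
  have hconn : M.coe.Preconnected := by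
    have key : ∀ (u v : a), ((restrictColoring C a).labelGraph α).Reachable u v →
        ∀ (hu : u ∈ M.verts) (hv : v ∈ M.verts), M.coe.Reachable ⟨u, hu⟩ ⟨v, hv⟩ := by
      rintro u v ⟨p⟩
      induction p with
      | nil => exact fun _ _ => SimpleGraph.Reachable.refl _
      | @cons u t v h p ih =>
        intro hu hv'
        have ht : t ∈ M.verts := by
          rw [hv] at hu ⊢
          exact (SimpleGraph.ConnectedComponent.mem_supp_congr_adj k h).1 hu
        exact ((hMadj ⟨u, hu⟩ ⟨t, ht⟩).2 h).reachable.trans (ih ht hv')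
    intro u v
    have hu : u.1 ∈ k.supp := hv ▸ u.2
    have hv' : v.1 ∈ k.supp := hv ▸ v.2
    exact key u v (SimpleGraph.ConnectedComponent.exact (hu.trans hv'.symm)) u.2 v.2
  have : Nontrivial M.verts := hnt.coe_sort
  exact isOfTypeP1P3C5_of_colorClass hconn
    (fun u v => by
      by_cases h : u = v
      · rw [h]
      · rw [hcv u v h, hcv v u (Ne.symm h)]
        exact SimpleGraph.EdgeLabeling.get_comm _ _ _)
    hA (fun u v w h1 h2 h3 => (htriple u v w h1 h2 h3).1)
    (fun u v w h1 h2 h3 => (htriple u v w h1 h2 h3).2)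

/-! ### The converse: constructing the coloring. -/

/-- The graphs of type `P₁`, `P₃` or `C₅` are connected and nonempty; up to twins they have neither
triangles nor independent sets of size three. -/
theorem IsOfTypeP1P3C5.properties {V : Type*} {G : SimpleGraph V} (h : IsOfTypeP1P3C5 G) :
    Nonempty V ∧ G.Preconnected ∧ (∀ u v w, G.Adj u v → G.Adj v w → ¬ G.Adj u w) ∧
      ∀ u v w, G.neighborSet u ≠ G.neighborSet v → G.neighborSet v ≠ G.neighborSet w →
        G.neighborSet u ≠ G.neighborSet w → G.Adj u v ∨ G.Adj v w ∨ G.Adj u w := by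
  -- `Fin (n + 2)` makes the reduced form nontrivial, without which connectedness need not lift:
  -- edgeless graphs reduce to a point.
  have transfer : ∀ (n : ℕ) (K : SimpleGraph (Fin (n + 2))), IsOfType G K → K.Preconnected →
      (∀ u v w, K.Adj u v → K.Adj v w → ¬ K.Adj u w) →
      (∀ u v w, u ≠ v → v ≠ w → u ≠ w → K.Adj u v ∨ K.Adj v w ∨ K.Adj u w) →
      Nonempty V ∧ G.Preconnected ∧ (∀ u v w, G.Adj u v → G.Adj v w → ¬ G.Adj u w) ∧
      ∀ u v w, G.neighborSet u ≠ G.neighborSet v → G.neighborSet v ≠ G.neighborSet w →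
        G.neighborSet u ≠ G.neighborSet w → G.Adj u v ∨ G.Adj v w ∨ G.Adj u w := by
    rintro n K ⟨f⟩ hK h3 hi
    refine ⟨?_, ?_, ?_, ?_⟩
    · exact ⟨(f.symm 0).2.choose⟩
    · exact preconnected_of_reducedForm G (f.symm.preconnected_iff.1 hK) f.toEquiv.nontrivial
    · intro u v w
      have := h3 (f ⟨_, u, rfl⟩) (f ⟨_, v, rfl⟩) (f ⟨_, w, rfl⟩)
      simpa only [f.map_adj_iff, reducedForm_adj_mk] using this
    · intro u v w h1 h2 h3
      have := hi (f ⟨_, u, rfl⟩) (f ⟨_, v, rfl⟩) (f ⟨_, w, rfl⟩)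
        (fun e => h1 (congrArg Subtype.val (f.injective e)))
        (fun e => h2 (congrArg Subtype.val (f.injective e)))
        (fun e => h3 (congrArg Subtype.val (f.injective e)))
      simpa only [f.map_adj_iff, reducedForm_adj_mk] using this
  rcases h with h | h | h
  · exact transfer 0 _ h (SimpleGraph.pathGraph_preconnected _)
      (by simp only [SimpleGraph.pathGraph_adj]; decide)
      (by simp only [SimpleGraph.pathGraph_adj]; decide)
  · exact transfer 2 _ h (SimpleGraph.pathGraph_preconnected _)
      (by simp only [SimpleGraph.pathGraph_adj]; decide)
      (by simp only [SimpleGraph.pathGraph_adj]; decide)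
  · exact transfer 3 _ h SimpleGraph.cycleGraph_preconnected
      (by simp only [SimpleGraph.cycleGraph_adj]; decide)
      (by simp only [SimpleGraph.cycleGraph_adj]; decide)

open Classical in
/-- A coloring of the pairs of vertices of a graph: edges get the color `inr true`, pairs of twins
the smaller of the two vertices, and the other pairs the color `inr false`. -/
noncomputable def twinColor {n : ℕ} (G : SimpleGraph (Fin n)) (u v : Fin n) : Fin n ⊕ Bool :=
  if G.Adj u v then Sum.inr true
  else if G.neighborSet u = G.neighborSet v then Sum.inl (min u v) else Sum.inr false

theorem twinColor_comm {n : ℕ} (G : SimpleGraph (Fin n)) (u v : Fin n) :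
    twinColor G u v = twinColor G v u := by
  have := G.adj_comm u v
  have := min_comm u v
  unfold twinColor
  grind

theorem twinColor_eq_inr_true {n : ℕ} (G : SimpleGraph (Fin n)) (u v : Fin n) :
    twinColor G u v = Sum.inr true ↔ G.Adj u v := by
  unfold twinColor
  split_ifs <;> simp_all

/-- Mutual twins `u < v < w` get the colors `u, u, v`. If only one pair are twins, the third vertex
sees both in the same `inr` color. Without twins only the two `inr` colors occur, and `htri` and
`hind` prevent either from filling the triangle. -/
theorem twinColor_triangle {n : ℕ} {G : SimpleGraph (Fin n)}
    (htri : ∀ u v w, G.Adj u v → G.Adj v w → ¬ G.Adj u w)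
    (hind : ∀ u v w, G.neighborSet u ≠ G.neighborSet v → G.neighborSet v ≠ G.neighborSet w →
        G.neighborSet u ≠ G.neighborSet w → G.Adj u v ∨ G.Adj v w ∨ G.Adj u w)
    {u v w : Fin n} (huv : u ≠ v) (hvw : v ≠ w) (hwu : w ≠ u) :
    ({twinColor G u v, twinColor G v w, twinColor G w u} : Set (Fin n ⊕ Bool)).ncard = 2 := by
  rw [Set.ncard_triple_eq_two_iff]
  have hsymm : ∀ u v, G.Adj u v → G.Adj v u := fun _ _ h => h.symm
  have htw : ∀ u v, G.neighborSet u = G.neighborSet v → ∀ w, G.Adj u w ↔ G.Adj v w :=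
    fun u v => (neighborSet_eq_iff G).1
  have hirr : ∀ u, ¬ G.Adj u u := fun u => G.loopless.irrefl u
  have h1 := htri u v w
  have h2 := hind u v w
  have huv' := htw u v
  have hvw' := htw v w
  have hwu' := htw w u
  unfold twinColor
  grind

/-- Every graph of type `P₁`, `P₃` or `C₅` on `Fin n` is a spanning monochrome of an exact Gallai
clique. -/
theorem exists_spanning_monochrome {n : ℕ} {H : SimpleGraph (Fin n)} (hH : IsOfTypeP1P3C5 H) :
    ∃ (C : (⊤ : SimpleGraph (Fin n)).EdgeLabeling (Fin n ⊕ Bool)),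
      IsExactGallaiClique C Set.univ ∧
      ∃ M : ((⊤ : SimpleGraph (Fin n)).induce Set.univ).Subgraph,
        IsMonochrome (restrictColoring C Set.univ) M ∧ M.IsSpanning ∧
          Nonempty (M.coe ≃g H) := by
  obtain ⟨⟨x⟩, hc, htri, hind⟩ := hH.properties
  let C : (⊤ : SimpleGraph (Fin n)).EdgeLabeling (Fin n ⊕ Bool) :=
    SimpleGraph.EdgeLabeling.mk (fun u v _ => twinColor H u v) fun u v _ => twinColor_comm H v u
  have hC : ∀ u v h, C.get u v h = twinColor H u v := fun _ _ _ => rfl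
  have hadj : ∀ u v : (Set.univ : Set (Fin n)),
      ((restrictColoring C Set.univ).labelGraph (Sum.inr true)).Adj u v ↔ H.Adj u v := by
    intro u v
    rw [SimpleGraph.EdgeLabeling.labelGraph_adj, ← twinColor_eq_inr_true H]
    constructor
    · exact fun ⟨_, e⟩ => e
    · intro e
      exact ⟨((twinColor_eq_inr_true H _ _).1 e).ne, e⟩
  have hreach : ∀ u : (Set.univ : Set (Fin n)),
      ((restrictColoring C Set.univ).labelGraph (Sum.inr true)).Reachable u ⟨x, trivial⟩ := by
    intro u
    refine SimpleGraph.Reachable.symm ?_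
    exact hc.forall_of_closed
      (P := fun t => ((restrictColoring C Set.univ).labelGraph (Sum.inr true)).Reachable
        ⟨x, trivial⟩ ⟨t, trivial⟩)
      (fun s t hst hs => hs.trans ((hadj ⟨s, trivial⟩ ⟨t, trivial⟩).2 hst).reachable)
      (SimpleGraph.Reachable.refl _) u.1
  have hsupp : ∀ u : (Set.univ : Set (Fin n)),
      u ∈ (((restrictColoring C Set.univ).labelGraph (Sum.inr true)).connectedComponentMk
        ⟨x, trivial⟩).supp := fun u => SimpleGraph.ConnectedComponent.sound (hreach u)
  have htwo : ∀ u v w : Fin n, u ≠ v → v ≠ w → w ≠ u → _ := fun u v w =>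
    twinColor_triangle htri hind (u := u) (v := v) (w := w)
  refine ⟨C, ⟨⟨⟨x, trivial⟩, fun u _ v _ h => h, ?_⟩, ?_⟩, ⟨Set.univ, fun u v => H.Adj u v,
    fun {u v} h => ?_, fun _ => trivial, ⟨fun u v h => h.symm⟩⟩, ⟨Sum.inr true,
    ((restrictColoring C Set.univ).labelGraph (Sum.inr true)).connectedComponentMk ⟨x, trivial⟩,
    ?_, ?_⟩, fun _ => trivial, ⟨⟨?_, ?_⟩⟩⟩
  · intro u _ v _ w _ huv hvw hwu
    rw [hC, hC, hC]
    have := Set.ncard_triple_eq_two_iff.1 (htwo u v w huv hvw hwu)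
    grind
  · intro u _ v _ w _ huv hvw hwu
    exact htwo u v w huv hvw hwu
  · exact fun e => h.ne e
  · exact (Set.eq_univ_of_forall hsupp).symm
  · intro u v
    simp only [hsupp u, hsupp v, true_and, hadj]
  · exact (Equiv.Set.univ _).trans (Equiv.Set.univ _)
  · rfl

/-- Allows moving to `Fin n`, whose order `twinColor` needs. -/
theorem IsOfTypeP1P3C5.of_iso {V W : Type*} {G : SimpleGraph V} {H : SimpleGraph W} (e : G ≃g H)
    (h : IsOfTypeP1P3C5 G) : IsOfTypeP1P3C5 H := by
  have htw : ∀ u v, G.neighborSet u = G.neighborSet v ↔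
      H.neighborSet (e u) = H.neighborSet (e v) := by
    intro u v
    rw [neighborSet_eq_iff, neighborSet_eq_iff, e.surjective.forall]
    simp only [e.map_adj_iff]
  let f : Set.range G.neighborSet → Set.range H.neighborSet :=
    fun A => ⟨H.neighborSet (e A.2.choose), _, rfl⟩
  have hf : ∀ u, f ⟨_, u, rfl⟩ = ⟨H.neighborSet (e u), _, rfl⟩ := fun u =>
    Subtype.ext ((htw _ _).1 (Set.mem_range_self (f := G.neighborSet) u).choose_spec)
  obtain ⟨i⟩ : Nonempty (reducedForm H ≃g reducedForm G) := by
    refine nonempty_iso_of_bijective f ⟨?_, ?_⟩ ?_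
    · rintro ⟨_, u, rfl⟩ ⟨_, v, rfl⟩ h
      rw [hf, hf] at h
      exact Subtype.ext ((htw u v).2 (congrArg Subtype.val h))
    · rintro ⟨_, w, rfl⟩
      obtain ⟨u, rfl⟩ := e.surjective w
      exact ⟨_, hf u⟩
    · rintro ⟨_, u, rfl⟩ ⟨_, v, rfl⟩
      rw [hf, hf, reducedForm_adj_mk, reducedForm_adj_mk, e.map_adj_iff]
  exact h.imp (fun ⟨j⟩ => ⟨i.trans j⟩) (Or.imp (fun ⟨j⟩ => ⟨i.trans j⟩) fun ⟨j⟩ => ⟨i.trans j⟩)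

theorem mainTheorem6 :
    (∀ (V : Type*) (Γ : Type*) [Finite V] [Finite Γ] (G : SimpleGraph V)
        (C : G.EdgeLabeling Γ) (a : Set V), IsExactGallaiClique C a →
        ∀ M : (G.induce a).Subgraph, IsMonochrome (restrictColoring C a) M →
          M.verts.Nontrivial → IsOfTypeP1P3C5 M.coe) ∧
    (∀ (W : Type*) [Finite W] (H : SimpleGraph W), IsOfTypeP1P3C5 H →
        ∃ (V : Type) (Γ : Type) (_ : Finite V) (_ : Finite Γ) (G : SimpleGraph V)
          (C : G.EdgeLabeling Γ) (a : Set V), IsExactGallaiClique C a ∧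
          ∃ M : (G.induce a).Subgraph, IsMonochrome (restrictColoring C a) M ∧
            M.IsSpanning ∧ Nonempty (M.coe ≃g H)) := by
  refine ⟨fun V Γ _ _ G C a ha M hM hnt => isOfTypeP1P3C5_of_isMonochrome ha hM hnt,
    fun W _ H hH => ?_⟩
  obtain ⟨n, ⟨e⟩⟩ := Finite.exists_equiv_fin W
  let i : H ≃g H.map e.toEmbedding := SimpleGraph.Iso.map e H
  obtain ⟨C, hC, M, hM, hsp, ⟨j⟩⟩ := exists_spanning_monochrome (hH.of_iso i)
  exact ⟨Fin n, Fin n ⊕ Bool, inferInstance, inferInstance, ⊤, C, Set.univ, hC, M, hM, hsp,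
    ⟨j.trans i.symm⟩⟩
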